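/- Let $\mathcal H$ be a real Hilbert space, let $f\colon\mathcal H\to\mathbb R$ be convex and Fréchet differentiable with $\beta$-Lipschitz continuous gradient, where $\beta\in\,]0,+\infty[$, let $g\colon\mathcal H\to\,]-\infty,+\infty]$ be convex, lower semicontinuous and proper, and let $\gamma\in\,]0,1/\beta]$. Let $T=\operatorname{prox}_{\gamma g}\circ(\operatorname{Id}-\gamma\nabla f)$ be the forward-backward operator, where $\operatorname{prox}_{\gamma g}(y)$ denotes the unique minimizer of $u\mapsto \gamma g(u)+\tfrac12\|u-y\|^2$. Let $x_0\in\mathcal H$, $y_1=x_0$ and, for $n=1,2,\dots$, $$x_n=Ty_n,\qquad y_{n+1}=x_n+\frac{\tau_n-1}{\tau_{n+1}}(x_n-x_{n-1}),$$ where $\tau_n=1$ for all $n\ge1$ (the unaccelerated proximal gradient method). Then $0$ has a unique nearest point $v$ in the set $\overline{\operatorname{ran}}(\operatorname{Id}-T)$, that is, the projection $v$ of $0$ onto this set (the minimal displacement vector of $T$) is well defined, and $$x_{n-1}-x_n\to v,\quad\text{i.e.}\quad x_n-x_{n-1}\to -v,$$ strongly in $\mathcal H$ as $n\to+\infty$.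 -/

import Mathlib

open Set Filter Topology

namespace ProxGrad

section

variable {H : Type*} [NormedAddCommGroup H] [InnerProductSpace ℝ H]

/-- Convexity of an extended-real-valued function: its epigraph is convex. -/
def ConvexEReal (g : H → EReal) : Prop :=
  Convex ℝ {p : H × ℝ | g p.1 ≤ (p.2 : EReal)}

/-- A function is proper if it never takes the value `-∞` and is finite somewhere. -/
def Proper (g : H → EReal) : Prop :=
  (∀ x, g x ≠ ⊥) ∧ ∃ x, g x ≠ ⊤

/-- `p` minimizes `u ↦ φ u + (1/2) ‖u - y‖ ^ 2` over `H`. -/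
def IsProxPoint (φ : H → EReal) (y p : H) : Prop :=
  ∀ u : H, φ p + (((1 / 2 : ℝ) * ‖p - y‖ ^ 2 : ℝ) : EReal)
    ≤ φ u + (((1 / 2 : ℝ) * ‖u - y‖ ^ 2 : ℝ) : EReal)

open Classical in
/-- The proximity operator of `φ`: `prox φ y` is the minimizer of `u ↦ φ u + (1/2) ‖u - y‖ ^ 2`.
For `φ` convex, lower semicontinuous and proper on a Hilbert space the minimizer exists and is
unique; the value `y` in the other branch is never used there. -/
noncomputable def prox (φ : H → EReal) (y : H) : H :=
  if h : ∃ p, IsProxPoint φ y p then h.choose else y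

/-- The forward-backward operator `T = prox_{γ g} ∘ (Id - γ ∇f)`. -/
noncomputable def fbOp [CompleteSpace H] (f : H → ℝ) (g : H → EReal) (γ : ℝ) (x : H) : H :=
  prox (fun u => (γ : EReal) * g u) (x - γ • gradient f x)

/-- `x` (indexed by `0, 1, 2, …`) is a FISTA sequence for the operator `T`, with parameters
`τ` and auxiliary points `y`, both indexed by `1, 2, …` (the values `τ 0`, `y 0` play no role):
`y 1 = x 0` and, for all `n ≥ 1`, `x n = T (y n)` and
`y (n + 1) = x n + ((τ n - 1) / τ (n + 1)) • (x n - x (n - 1))`. -/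
structure IsFISTA (T : H → H) (τ : ℕ → ℝ) (x y : ℕ → H) : Prop where
  init : y 1 = x 0
  x_step : ∀ n : ℕ, 1 ≤ n → x n = T (y n)
  y_step : ∀ n : ℕ, 1 ≤ n → y (n + 1) = x n + ((τ n - 1) / τ (n + 1)) • (x n - x (n - 1))

/-- `p` is a nearest point to `x` in the set `C`. -/
def IsProjection (C : Set H) (x p : H) : Prop :=
  p ∈ C ∧ ∀ c ∈ C, ‖x - p‖ ≤ ‖x - c‖

end

end ProxGrad

/-! With all `τ n = 1` the extrapolation vanishes, so `x` is an orbit of `T`. Firm nonexpansiveness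
of the prox (`prox_firmlyNonexpansive`) and Baillon–Haddad (`gradient_cocoercive`) make `Id - T`
3/4-cocoercive (`fbOp_displacement_cocoercive`); only this is used afterwards.

Monotonicity of `Id - T` and its resolvents yield a point `v` of the closed range with `‖v‖ ^ 2 ≤ ⟪y
- T y, v⟫` for all `y`, which makes `v` the unique nearest point to `0`. Since 3/4 > 1/2,
displacements along any two orbits become equal. Comparison with orbits started at nearly minimal
displacement gives convergence of norms to `‖v‖`, and the variational inequality upgrades this to
strong convergence. -/

namespace ProxGrad

open scoped RealInnerProductSpace

variable {H : Type*} [NormedAddCommGroup H]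

/-! ### Real epigraphs of scaled extended-valued functions. -/

section Epigraph

variable {g : H → EReal} {γ : ℝ}

/-- Moving `γ` to the real side makes the epigraph of `γ g` a rescaled copy of that of `g`. -/
theorem coe_mul_le_coe_iff {γ : ℝ} (hγ : 0 < γ) (a : EReal) (r : ℝ) :
    (γ : EReal) * a ≤ r ↔ a ≤ ((r / γ : ℝ) : EReal) := by
  induction a with
  | bot => simp [EReal.coe_mul_bot_of_pos hγ]
  | top => simp [EReal.coe_mul_top_of_pos hγ]
  | coe a =>
    rw [← EReal.coe_mul, EReal.coe_le_coe_iff, EReal.coe_le_coe_iff, le_div_iff₀ hγ, mul_comm]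

theorem isClosed_epigraph_const_mul (hg : LowerSemicontinuous g) (hγ : 0 < γ) :
    IsClosed {p : H × ℝ | (γ : EReal) * g p.1 ≤ p.2} := by
  simp only [coe_mul_le_coe_iff hγ]
  have hc : Continuous fun p : H × ℝ => (p.1, ((p.2 / γ : ℝ) : EReal)) :=
    continuous_fst.prodMk (continuous_coe_real_ereal.comp (by fun_prop))
  exact hg.isClosed_epigraph.preimage hc

theorem isProxPoint_prox {φ : H → EReal} {y : H} (h : ∃ p, IsProxPoint φ y p) :
    IsProxPoint φ y (prox φ y) := by
  rw [prox, dif_pos h]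
  exact h.choose_spec

/-- A proximal point is a minimizer over the epigraph. -/
theorem IsProxPoint.exists_epigraph_min (hprop : Proper g) (hγ : 0 < γ) {y p : H}
    (hp : IsProxPoint (fun u => (γ : EReal) * g u) y p) :
    ∃ q : ℝ, (γ : EReal) * g p ≤ q ∧ ∀ (u : H) (r : ℝ), (γ : EReal) * g u ≤ r →
      q + 1 / 2 * ‖p - y‖ ^ 2 ≤ r + 1 / 2 * ‖u - y‖ ^ 2 := by
  obtain ⟨hbot, a, ha⟩ := hprop
  have hpt : g p ≠ ⊤ := by
    intro h
    have := hp a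
    lift g a to ℝ using ⟨ha, hbot a⟩ with ga
    simp only [h, EReal.coe_mul_top_of_pos hγ, EReal.top_add_coe, top_le_iff] at this
    exact EReal.coe_ne_top (γ * ga + 1 / 2 * ‖a - y‖ ^ 2) (by exact_mod_cast this)
  lift g p to ℝ using ⟨hpt, hbot p⟩ with gp hgp
  refine ⟨γ * gp, by simp, fun u r hu => ?_⟩
  have h := (hp u).trans (add_le_add_left hu _)
  simp only [← hgp] at h
  exact_mod_cast h

end Epigraph

variable [InnerProductSpace ℝ H]

/-! ### Existence and variational inequality for proximal minimizers. -/

section Minimization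

/-- A closed convex upward closed set in `H × ℝ` that misses a point of the vertical line through
one of its points lies above a function of linear growth. -/
theorem exists_linear_growth_minorant {E : Set (H × ℝ)} (hE : Convex ℝ E) (hcl : IsClosed E)
    (hup : ∀ u r s, (u, r) ∈ E → r ≤ s → (u, s) ∈ E) {a : H} {r₀ s₀ : ℝ}
    (hr : (a, r₀) ∈ E) (hs : (a, s₀) ∉ E) :
    ∃ c k : ℝ, ∀ u r, (u, r) ∈ E → c - k * ‖u - a‖ ≤ r := by
  obtain ⟨δ, hδ, hball⟩ := Metric.isOpen_iff.1 hcl.isOpen_compl _ hs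
  have hnear : ∀ u r, (u, r) ∈ E → ‖u - a‖ < δ → s₀ ≤ r := by
    intro u r hu hd
    by_contra! h
    refine hball (a := (u, s₀)) ?_ (hup _ _ _ hu h.le)
    simpa [Prod.dist_eq, dist_eq_norm, hδ] using hd
  have hrs : s₀ < r₀ := by
    by_contra! h
    exact hs (hup _ _ _ hr h)
  refine ⟨s₀, 2 * (r₀ - s₀) / δ, fun u r hu => ?_⟩
  have hk : 0 ≤ 2 * (r₀ - s₀) / δ * ‖u - a‖ :=
    mul_nonneg (div_nonneg (by linarith) hδ.le) (norm_nonneg _)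
  by_cases hd : ‖u - a‖ < δ
  · linarith [hnear u r hu hd]
  push Not at hd
  have hpos : 0 < ‖u - a‖ := hδ.trans_le hd
  -- Moving from `a` a fraction `t` of the way to `u` covers distance `δ / 2`, where `s₀` is a lower
  -- bound; convexity carries it out to `u`.
  set t : ℝ := δ / (2 * ‖u - a‖) with ht
  have ht0 : 0 < t := by positivity
  have ht1 : t ≤ 1 := by
    rw [ht, div_le_one (by positivity)]
    linarith
  have hmem := hE hr hu (sub_nonneg.2 ht1) ht0.le (by ring)
  have hst := hnear ((1 - t) • a + t • u) ((1 - t) * r₀ + t * r) (by simpa using hmem) (by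
    have : (1 - t) • a + t • u - a = t • (u - a) := by module
    rw [this, norm_smul, Real.norm_of_nonneg ht0.le, ht]
    have : δ / (2 * ‖u - a‖) * ‖u - a‖ = δ / 2 := by field_simp
    linarith)
  have hkt : 2 * (r₀ - s₀) / δ * ‖u - a‖ = (r₀ - s₀) / t := by
    rw [ht]
    field_simp
  rw [hkt]
  have : r₀ - (r₀ - s₀) / t ≤ r := by
    rw [sub_le_iff_le_add, ← sub_le_iff_le_add', le_div_iff₀ ht0]
    nlinarith
  linarith

/-- Proximal minimization over a closed convex epigraph is attained. -/
theorem exists_min_add_half_sq [CompleteSpace H] {E : Set (H × ℝ)} (hE : Convex ℝ E)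
    (hcl : IsClosed E) (hup : ∀ u r s, (u, r) ∈ E → r ≤ s → (u, s) ∈ E) {a : H} {r₀ s₀ : ℝ}
    (hr : (a, r₀) ∈ E) (hs : (a, s₀) ∉ E) (y : H) :
    ∃ p q, (p, q) ∈ E ∧
      ∀ u r, (u, r) ∈ E → q + 1 / 2 * ‖p - y‖ ^ 2 ≤ r + 1 / 2 * ‖u - y‖ ^ 2 := by
  obtain ⟨c, k, hck⟩ := exists_linear_growth_minorant hE hcl hup hr hs
  let h : H × ℝ → ℝ := fun z => z.2 + 1 / 2 * ‖z.1 - y‖ ^ 2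
  have hne : (h '' E).Nonempty := ⟨_, _, hr, rfl⟩
  have hbdd : BddBelow (h '' E) := by
    refine ⟨c - |k| * ‖y - a‖ - 1 / 2 * |k| ^ 2, ?_⟩
    rintro _ ⟨⟨u, r⟩, hu, rfl⟩
    have h1 := hck u r hu
    have h2 : ‖u - a‖ ≤ ‖u - y‖ + ‖y - a‖ := norm_sub_le_norm_sub_add_norm_sub u y a
    have h3 : k * ‖u - a‖ ≤ |k| * ‖u - a‖ :=
      mul_le_mul_of_nonneg_right (le_abs_self k) (norm_nonneg _)
    have h4 := mul_le_mul_of_nonneg_left h2 (abs_nonneg k)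
    simp only [h]
    nlinarith [sq_nonneg (‖u - y‖ - |k|)]
  set m := sInf (h '' E)
  have hle : ∀ z ∈ E, m ≤ h z := fun z hz => csInf_le hbdd ⟨z, hz, rfl⟩
  have hseq : ∀ n : ℕ, ∃ z ∈ E, h z < m + 1 / ((n : ℝ) + 1) := by
    intro n
    obtain ⟨_, ⟨z, hz, rfl⟩, hlt⟩ :=
      exists_lt_of_csInf_lt hne (lt_add_of_pos_right m (Nat.one_div_pos_of_nat (α := ℝ) (n := n)))
    exact ⟨z, hz, hlt⟩
  choose z hz hzm using hseq
  have hlim0 : Tendsto (fun n : ℕ => 1 / ((n : ℝ) + 1)) atTop (𝓝 0) :=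
    tendsto_one_div_add_atTop_nhds_zero_nat
  have hcauchy : CauchySeq fun n => (z n).1 := by
    -- By the parallelogram law, `h` at a midpoint is below the average by at least 1/8 of the
    -- squared distance, yet it is at least `m`.
    refine cauchySeq_of_le_tendsto_0' (fun n : ℕ => √(8 * (1 / ((n : ℝ) + 1)))) ?_ ?_
    · intro n j hnj
      rw [dist_eq_norm]
      refine Real.le_sqrt_of_sq_le ?_
      have hmid := hle _ (hE (hz n) (hz j) (by norm_num : (0 : ℝ) ≤ 1 / 2)
        (by norm_num : (0 : ℝ) ≤ 1 / 2) (by norm_num))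
      have hj : 1 / ((j : ℝ) + 1) ≤ 1 / ((n : ℝ) + 1) := Nat.one_div_le_one_div hnj
      have hn := hzm n
      have hj' := hzm j
      simp only [h, Prod.fst_add, Prod.snd_add, Prod.smul_fst, Prod.smul_snd, smul_eq_mul]
        at hmid hn hj'
      have e1 : (1 / 2 : ℝ) • (z n).1 + (1 / 2 : ℝ) • (z j).1 - y
          = (1 / 2 : ℝ) • (((z n).1 - y) + ((z j).1 - y)) := by module
      have e2 : (z n).1 - (z j).1 = ((z n).1 - y) - ((z j).1 - y) := by abel
      rw [e1, norm_smul, mul_pow] at hmid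
      rw [e2]
      have hpar := parallelogram_law_with_norm ℝ ((z n).1 - y) ((z j).1 - y)
      norm_num at hmid
      nlinarith
    · have := (hlim0.const_mul 8).sqrt
      simpa using this
  obtain ⟨p, hp⟩ := cauchySeq_tendsto_of_complete hcauchy
  have hh : Tendsto (fun n => h (z n)) atTop (𝓝 m) :=
    tendsto_of_tendsto_of_tendsto_of_le_of_le tendsto_const_nhds
      (by simpa using tendsto_const_nhds.add hlim0) (fun n => hle _ (hz n)) (fun n => (hzm n).le)
  have hq : Tendsto (fun n => (z n).2) atTop (𝓝 (m - 1 / 2 * ‖p - y‖ ^ 2)) := by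
    have := hh.sub (((hp.sub_const y).norm.pow 2).const_mul (1 / 2))
    simpa [h] using this
  refine ⟨p, _, hcl.mem_of_tendsto (hp.prodMk_nhds hq) (Eventually.of_forall hz), fun u r hu => ?_⟩
  have := hle _ hu
  simp only [h] at this
  linarith

/-- The variational inequality satisfied by a proximal minimizer. -/
theorem inner_le_sub_of_isMin {E : Set (H × ℝ)} (hE : Convex ℝ E) {y p u : H} {q r : ℝ}
    (hp : (p, q) ∈ E)
    (hmin : ∀ u r, (u, r) ∈ E → q + 1 / 2 * ‖p - y‖ ^ 2 ≤ r + 1 / 2 * ‖u - y‖ ^ 2)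
    (hu : (u, r) ∈ E) : ⟪y - p, u - p⟫ ≤ r - q := by
  -- Minimality along the segment from `p` to `u`, divided by `t`; then `t` tends to 0.
  have key : ∀ t : ℝ, 0 < t → t ≤ 1 → ⟪y - p, u - p⟫ ≤ r - q + t * (1 / 2 * ‖u - p‖ ^ 2) := by
    intro t ht ht1
    have h1 := hmin ((1 - t) • p + t • u) ((1 - t) * q + t * r)
      (by simpa using hE hp hu (sub_nonneg.2 ht1) ht.le (by ring))
    have e : (1 - t) • p + t • u - y = t • (u - p) - (y - p) := by module
    rw [e, norm_sub_sq_real (t • (u - p)), norm_smul, mul_pow, real_inner_smul_left,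
      norm_sub_rev p y, real_inner_comm, Real.norm_of_nonneg ht.le] at h1
    refine le_of_mul_le_mul_left ?_ ht
    nlinarith
  have hlim : Tendsto (fun t : ℝ => r - q + t * (1 / 2 * ‖u - p‖ ^ 2)) (𝓝[>] 0) (𝓝 (r - q)) := by
    have : Continuous fun t : ℝ => r - q + t * (1 / 2 * ‖u - p‖ ^ 2) := by fun_prop
    simpa using (this.tendsto 0).mono_left nhdsWithin_le_nhds
  refine ge_of_tendsto hlim ?_
  filter_upwards [Ioc_mem_nhdsGT (zero_lt_one (α := ℝ))] with t ht using key t ht.1 ht.2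

end Minimization

/-! ### Existence and firm nonexpansiveness of the prox. -/

section Prox

variable {g : H → EReal} {γ : ℝ}

theorem convex_epigraph_const_mul (hg : ConvexEReal g) (hγ : 0 < γ) :
    Convex ℝ {p : H × ℝ | (γ : EReal) * g p.1 ≤ p.2} := by
  intro p hp q hq a b ha hb hab
  simp only [mem_ofPred_eq, coe_mul_le_coe_iff hγ] at hp hq ⊢
  have := hg (x := (p.1, p.2 / γ)) hp (y := (q.1, q.2 / γ)) hq ha hb hab
  simp only [mem_ofPred_eq, Prod.fst_add, Prod.snd_add, Prod.smul_fst, Prod.smul_snd,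
    smul_eq_mul] at this ⊢
  convert this using 2
  ring

theorem exists_isProxPoint [CompleteSpace H] (hconv : ConvexEReal g)
    (hlsc : LowerSemicontinuous g) (hprop : Proper g) (hγ : 0 < γ) (y : H) :
    ∃ p, IsProxPoint (fun u => (γ : EReal) * g u) y p := by
  obtain ⟨hbot, a, ha⟩ := hprop
  lift g a to ℝ using ⟨ha, hbot a⟩ with ga hga
  obtain ⟨p, q, hpq, hmin⟩ := exists_min_add_half_sq (convex_epigraph_const_mul hconv hγ)
    (isClosed_epigraph_const_mul hlsc hγ)
    (fun u r s hu hrs => le_trans hu (EReal.coe_le_coe_iff.2 hrs))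
    (a := a) (r₀ := γ * ga) (s₀ := γ * ga - 1)
    (by simp [← hga])
    (by
      simp only [mem_ofPred_eq, ← hga, ← EReal.coe_mul, EReal.coe_le_coe_iff]
      linarith) y
  refine ⟨p, fun u => ?_⟩
  refine (add_le_add_left (show (γ : EReal) * g p ≤ q from hpq) _).trans ?_
  by_cases hu : g u = ⊤
  · simp only [hu, EReal.coe_mul_top_of_pos hγ, EReal.top_add_coe, le_top]
  lift g u to ℝ using ⟨hu, hbot u⟩ with gu hgu
  have := hmin u (γ * gu) (by simp [← hgu])
  exact_mod_cast this

/-- Each prox point is tested in the variational inequality of the other; on adding, the epigraph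
heights cancel. -/
theorem prox_firmlyNonexpansive [CompleteSpace H] (hconv : ConvexEReal g)
    (hlsc : LowerSemicontinuous g) (hprop : Proper g) (hγ : 0 < γ) (y z : H) :
    ‖prox (fun u => (γ : EReal) * g u) y - prox (fun u => (γ : EReal) * g u) z‖ ^ 2 ≤
      ⟪prox (fun u => (γ : EReal) * g u) y - prox (fun u => (γ : EReal) * g u) z, y - z⟫ := by
  have hy := isProxPoint_prox (exists_isProxPoint hconv hlsc hprop hγ y)
  have hz := isProxPoint_prox (exists_isProxPoint hconv hlsc hprop hγ z)
  set p := prox (fun u => (γ : EReal) * g u) y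
  set q := prox (fun u => (γ : EReal) * g u) z
  obtain ⟨r, hr, hrmin⟩ := hy.exists_epigraph_min hprop hγ
  obtain ⟨s, hs, hsmin⟩ := hz.exists_epigraph_min hprop hγ
  have hE := convex_epigraph_const_mul hconv hγ
  have h1 := inner_le_sub_of_isMin hE (p := p) hr hrmin (u := q) hs
  have h2 := inner_le_sub_of_isMin hE (p := q) hs hsmin (u := p) hr
  rw [← real_inner_self_eq_norm_sq]
  simp only [inner_sub_left, inner_sub_right, real_inner_comm] at h1 h2 ⊢
  linarith [real_inner_comm p q, real_inner_comm p y, real_inner_comm p z, real_inner_comm q y,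
    real_inner_comm q z]

end Prox

/-! ### Cocoercivity of a Lipschitz gradient of a convex function. -/

section Gradient

variable [CompleteSpace H] {f : H → ℝ}

theorem hasDerivAt_comp_line (hf : Differentiable ℝ f) (a d : H) (t : ℝ) :
    HasDerivAt (fun t : ℝ => f (a + t • d)) ⟪gradient f (a + t • d), d⟫ t := by
  have h1 : HasDerivAt (fun t : ℝ => a + t • d) d t := by
    simpa using ((hasDerivAt_id t).smul_const d).const_add a
  have h2 := (hf (a + t • d)).hasGradientAt.hasFDerivAt
  exact h2.comp_hasDerivAt t h1

theorem add_inner_gradient_le (hc : ConvexOn ℝ univ f) (hf : Differentiable ℝ f) (a b : H) :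
    f a + ⟪gradient f a, b - a⟫ ≤ f b := by
  have hcl : ConvexOn ℝ univ fun t : ℝ => f (a + t • (b - a)) := by
    have := hc.comp_affineMap (AffineMap.lineMap a b : ℝ →ᵃ[ℝ] H)
    simpa [Function.comp_def, AffineMap.lineMap_apply, add_comm] using this
  have h := hcl.le_slope_of_hasDerivAt (mem_univ 0) (mem_univ 1) zero_lt_one
    (hasDerivAt_comp_line hf a (b - a) 0)
  simp only [slope_def_field, zero_smul, add_zero, one_smul, add_sub_cancel, sub_zero,
    div_one] at h
  linarith

variable {β : ℝ}

/-- The descent lemma. -/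
theorem le_add_inner_gradient_add_sq (hf : Differentiable ℝ f)
    (hL : ∀ a b : H, ‖gradient f a - gradient f b‖ ≤ β * ‖a - b‖) (a b : H) :
    f b ≤ f a + ⟪gradient f a, b - a⟫ + β / 2 * ‖b - a‖ ^ 2 := by
  set d := b - a with hd
  let φ : ℝ → ℝ := fun t => f (a + t • d) - t * ⟪gradient f a, d⟫ - β / 2 * ‖d‖ ^ 2 * t ^ 2
  have hφ : ∀ t, HasDerivAt φ
      (⟪gradient f (a + t • d), d⟫ - ⟪gradient f a, d⟫ - β * ‖d‖ ^ 2 * t) t := by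
    intro t
    have := ((hasDerivAt_comp_line hf a d t).sub
      ((hasDerivAt_id t).mul_const ⟪gradient f a, d⟫)).sub
      ((hasDerivAt_pow 2 t).const_mul (β / 2 * ‖d‖ ^ 2))
    refine this.congr_deriv ?_
    push_cast
    ring
  have hanti : AntitoneOn φ (Icc 0 1) := by
    refine antitoneOn_of_deriv_nonpos (convex_Icc 0 1)
      (fun t _ => (hφ t).continuousAt.continuousWithinAt)
      (fun t _ => (hφ t).differentiableAt.differentiableWithinAt) fun t ht => ?_
    rw [interior_Icc] at ht
    rw [(hφ t).deriv, ← inner_sub_left]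
    have h1 := real_inner_le_norm (gradient f (a + t • d) - gradient f a) d
    have h2 := hL (a + t • d) a
    rw [add_sub_cancel_left, norm_smul, Real.norm_of_nonneg ht.1.le] at h2
    nlinarith [mul_le_mul_of_nonneg_right h2 (norm_nonneg d)]
  have h := hanti (left_mem_Icc.2 zero_le_one) (right_mem_Icc.2 zero_le_one) zero_le_one
  simp only [φ, one_smul, zero_smul, add_zero, hd, add_sub_cancel] at h
  rw [← hd] at h
  linarith

/-- At `b - β⁻¹ • e`, one gradient step from `b` for `f - ⟪gradient f a, ·⟫`, the tangent bound at
`a` meets the descent bound at `b`. -/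
theorem add_inner_gradient_add_sq_le (hc : ConvexOn ℝ univ f) (hf : Differentiable ℝ f)
    (hβ : 0 < β) (hL : ∀ a b : H, ‖gradient f a - gradient f b‖ ≤ β * ‖a - b‖) (a b : H) :
    f a + ⟪gradient f a, b - a⟫ + 1 / (2 * β) * ‖gradient f b - gradient f a‖ ^ 2 ≤ f b := by
  set e := gradient f b - gradient f a with he
  have h1 := add_inner_gradient_le hc hf a (b - β⁻¹ • e)
  have h2 := le_add_inner_gradient_add_sq hf hL b (b - β⁻¹ • e)
  have e1 : b - β⁻¹ • e - a = (b - a) - β⁻¹ • e := by abel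
  have e2 : b - β⁻¹ • e - b = -(β⁻¹ • e) := by abel
  rw [e1, inner_sub_right, real_inner_smul_right] at h1
  rw [e2, inner_neg_right, real_inner_smul_right, norm_neg, norm_smul, mul_pow,
    Real.norm_of_nonneg (inv_nonneg.2 hβ.le)] at h2
  have h3 : ⟪gradient f b, e⟫ - ⟪gradient f a, e⟫ = ‖e‖ ^ 2 := by
    rw [← inner_sub_left, ← he, real_inner_self_eq_norm_sq]
  have h4 : β / 2 * (β⁻¹ ^ 2 * ‖e‖ ^ 2) = 1 / (2 * β) * ‖e‖ ^ 2 := by field_simp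
  have h5 : β⁻¹ * ⟪gradient f b, e⟫ - β⁻¹ * ⟪gradient f a, e⟫ = 2 * (1 / (2 * β) * ‖e‖ ^ 2) := by
    rw [← mul_sub, h3]
    field_simp
  linarith

/-- The Baillon–Haddad theorem. -/
theorem gradient_cocoercive (hc : ConvexOn ℝ univ f) (hf : Differentiable ℝ f)
    (hβ : 0 < β) (hL : ∀ a b : H, ‖gradient f a - gradient f b‖ ≤ β * ‖a - b‖) (a b : H) :
    1 / β * ‖gradient f a - gradient f b‖ ^ 2 ≤ ⟪gradient f a - gradient f b, a - b⟫ := by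
  have h1 := add_inner_gradient_add_sq_le hc hf hβ hL a b
  have h2 := add_inner_gradient_add_sq_le hc hf hβ hL b a
  rw [norm_sub_rev] at h1
  have e : ⟪gradient f a, b - a⟫ = -⟪gradient f a, a - b⟫ := by rw [← inner_neg_right, neg_sub]
  have e2 : 1 / β = 2 * (1 / (2 * β)) := by field_simp
  rw [inner_sub_left, e2]
  linarith

end Gradient

/-- The displacement map of the forward-backward operator is `3/4`-cocoercive. -/
theorem fbOp_displacement_cocoercive [CompleteSpace H] {f : H → ℝ} {g : H → EReal} {β γ : ℝ}
    (hc : ConvexOn ℝ univ f) (hf : Differentiable ℝ f) (hβ : 0 < β)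
    (hL : ∀ a b : H, ‖gradient f a - gradient f b‖ ≤ β * ‖a - b‖)
    (hconv : ConvexEReal g) (hlsc : LowerSemicontinuous g) (hprop : Proper g)
    (hγ : 0 < γ) (hγβ : γ ≤ 1 / β) (x y : H) :
    3 / 4 * ‖(x - fbOp f g γ x) - (y - fbOp f g γ y)‖ ^ 2 ≤
      ⟪(x - fbOp f g γ x) - (y - fbOp f g γ y), x - y⟫ := by
  have h1 := prox_firmlyNonexpansive hconv hlsc hprop hγ
    (x - γ • gradient f x) (y - γ • gradient f y)
  have h2 : ‖γ • (gradient f x - gradient f y)‖ ^ 2 ≤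
      ⟪γ • (gradient f x - gradient f y), x - y⟫ := by
    rw [norm_smul, mul_pow, real_inner_smul_left, Real.norm_of_nonneg hγ.le, pow_two γ, mul_assoc]
    refine mul_le_mul_of_nonneg_left ?_ hγ.le
    exact (mul_le_mul_of_nonneg_right hγβ (sq_nonneg _)).trans
      (gradient_cocoercive hc hf hβ hL x y)
  change ‖fbOp f g γ x - fbOp f g γ y‖ ^ 2 ≤ ⟪fbOp f g γ x - fbOp f g γ y, _⟫ at h1
  generalize fbOp f g γ x = p at h1 ⊢
  generalize fbOp f g γ y = q at h1 ⊢
  have e1 : x - γ • gradient f x - (y - γ • gradient f y)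
      = (x - y) - γ • (gradient f x - gradient f y) := by module
  rw [e1] at h1
  generalize γ • (gradient f x - gradient f y) = a at h1 h2
  have e2 : p - q = (x - y) - ((x - p) - (y - q)) := by abel
  rw [e2] at h1
  generalize x - p - (y - q) = w at h1 ⊢
  generalize x - y = u at h1 h2 ⊢
  -- `h1` and `h2` give `‖w‖² ≤ ⟪w, u⟫ + ⟪a, w⟫ - ‖a‖²`; completing the square bounds the last two
  -- terms by `‖w‖² / 4`, whence 3/4.
  have h3 := sq_nonneg ‖a - (1 / 2 : ℝ) • w‖
  rw [← real_inner_self_eq_norm_sq] at h1 h2 h3 ⊢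
  simp only [inner_sub_left, inner_sub_right, real_inner_smul_left, real_inner_smul_right]
    at h1 h2 h3 ⊢
  linarith [real_inner_comm a w, real_inner_comm a u, real_inner_comm u w]

/-! ### Minimal displacement and orbits of maps with cocoercive displacement. -/

section Displacement

variable {T : H → H}

/-- The gain 1/2 is 2 · 3/4 - 1, from expanding the square. -/
theorem norm_sub_sq_le_of_displacement_cocoercive
    (hT : ∀ x y, 3 / 4 * ‖(x - T x) - (y - T y)‖ ^ 2 ≤ ⟪(x - T x) - (y - T y), x - y⟫) (x y : H) :
    ‖T x - T y‖ ^ 2 ≤ ‖x - y‖ ^ 2 - 1 / 2 * ‖(x - T x) - (y - T y)‖ ^ 2 := by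
  have h := hT x y
  have e : T x - T y = (x - y) - ((x - T x) - (y - T y)) := by abel
  rw [e, norm_sub_sq_real, real_inner_comm]
  linarith

theorem norm_sub_le_of_displacement_cocoercive
    (hT : ∀ x y, 3 / 4 * ‖(x - T x) - (y - T y)‖ ^ 2 ≤ ⟪(x - T x) - (y - T y), x - y⟫) (x y : H) :
    ‖T x - T y‖ ≤ ‖x - y‖ := by
  have := norm_sub_sq_le_of_displacement_cocoercive hT x y
  exact abs_le_of_sq_le_sq' (by linarith [sq_nonneg ‖(x - T x) - (y - T y)‖]) (norm_nonneg _) |>.2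

/-- The resolvent equation for the displacement map of a nonexpansive operator is solvable. -/
theorem exists_eq_neg_smul_displacement [CompleteSpace H] (hT : ∀ x y, ‖T x - T y‖ ≤ ‖x - y‖)
    {a : ℝ} (ha : 0 < a) : ∃ x, x = -(a • (x - T x)) := by
  have hk : 0 < 1 + a := by linarith
  -- The equation rearranges to `x = (a / (1 + a)) • T x`, a fixed-point problem for a contraction.
  have hlip : LipschitzWith (a / (1 + a)).toNNReal fun x => (a / (1 + a)) • T x := by
    refine LipschitzWith.of_dist_le_mul fun x y => ?_
    rw [Real.coe_toNNReal _ (by positivity), dist_eq_norm, dist_eq_norm, ← smul_sub, norm_smul,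
      Real.norm_of_nonneg (by positivity)]
    exact mul_le_mul_of_nonneg_left (hT x y) (by positivity)
  have hcon : ContractingWith (a / (1 + a)).toNNReal fun x => (a / (1 + a)) • T x := by
    refine ⟨?_, hlip⟩
    rw [Real.toNNReal_lt_one, div_lt_one hk]
    linarith
  refine ⟨hcon.fixedPoint, ?_⟩
  have h := hcon.fixedPoint_isFixedPt.eq
  generalize ContractingWith.fixedPoint _ hcon = x at h ⊢
  have h2 : (1 + a) • x = a • T x := by
    nth_rw 1 [← h]
    rw [smul_smul, mul_div_cancel₀ _ hk.ne']
  rw [smul_sub, ← h2]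
  module

/-- The minimal displacement vector exists, with its variational characterization. -/
theorem exists_minimal_displacement [CompleteSpace H]
    (hT : ∀ x y, 3 / 4 * ‖(x - T x) - (y - T y)‖ ^ 2 ≤ ⟪(x - T x) - (y - T y), x - y⟫) :
    ∃ v ∈ closure (range fun z => z - T z), ∀ y, ‖v‖ ^ 2 ≤ ⟪y - T y, v⟫ := by
  have hmono : ∀ x y, 0 ≤ ⟪(x - T x) - (y - T y), x - y⟫ :=
    fun x y => le_trans (by positivity) (hT x y)
  have hres : ∀ n : ℕ, ∃ x, x = -(((n : ℝ) + 1) • (x - T x)) := fun n =>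
    exists_eq_neg_smul_displacement (norm_sub_le_of_displacement_cocoercive hT) (by positivity)
  choose x hx using hres
  set w : ℕ → H := fun n => x n - T (x n) with hw
  have hxw : ∀ n, x n = -(((n : ℝ) + 1) • w n) := hx
  have hdist : ∀ n m : ℕ, n ≤ m → ‖w n - w m‖ ^ 2 ≤ ‖w n‖ ^ 2 - ‖w m‖ ^ 2 := by
    intro n m hnm
    have h := hmono (x n) (x m)
    change 0 ≤ ⟪w n - w m, x n - x m⟫ at h
    rw [hxw n, hxw m] at h
    simp only [inner_sub_left, inner_sub_right, inner_neg_right, real_inner_smul_right,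
      real_inner_self_eq_norm_sq, real_inner_comm (w n) (w m)] at h
    have hsq := norm_sub_sq_real (w n) (w m)
    have hnm' : (n : ℝ) ≤ m := by exact_mod_cast hnm
    -- This is twice the monotonicity inequality `h`, the cross term rewritten by `hsq`. Its right
    -- side being nonnegative forces `‖w n‖` to decrease.
    have h1 : ((n : ℝ) + m + 2) * ‖w n - w m‖ ^ 2 ≤ (m - n) * (‖w n‖ ^ 2 - ‖w m‖ ^ 2) := by
      rw [hsq]
      linarith
    have hn0 : (0 : ℝ) ≤ n := n.cast_nonneg
    have hpos : (0 : ℝ) < n + m + 2 := by positivity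
    have h2 : 0 ≤ (m - n) * (‖w n‖ ^ 2 - ‖w m‖ ^ 2) := le_trans (by positivity) h1
    rcases hnm'.eq_or_lt with heq | hlt
    · have : n = m := by exact_mod_cast heq
      simp [this]
    · have h3 : 0 ≤ ‖w n‖ ^ 2 - ‖w m‖ ^ 2 := nonneg_of_mul_nonneg_right h2 (sub_pos.2 hlt)
      refine le_of_mul_le_mul_left (h1.trans ?_) hpos
      exact mul_le_mul_of_nonneg_right (by linarith) h3
  have hanti : Antitone fun n => ‖w n‖ ^ 2 := fun n m hnm => by
    have := hdist n m hnm
    linarith [sq_nonneg ‖w n - w m‖]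
  have hbdd : BddBelow (range fun n => ‖w n‖ ^ 2) := ⟨0, by rintro _ ⟨n, rfl⟩; positivity⟩
  have hlim := tendsto_atTop_ciInf hanti hbdd
  set l := ⨅ n, ‖w n‖ ^ 2
  have hcauchy : CauchySeq w := by
    refine cauchySeq_of_le_tendsto_0' (fun n => √(‖w n‖ ^ 2 - l)) (fun n m hnm => ?_) ?_
    · rw [dist_eq_norm]
      refine Real.le_sqrt_of_sq_le ((hdist n m hnm).trans ?_)
      linarith [ciInf_le hbdd m]
    · simpa using (hlim.sub_const l).sqrt
  obtain ⟨v, hv⟩ := cauchySeq_tendsto_of_complete hcauchy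
  refine ⟨v, mem_closure_of_tendsto hv (Eventually.of_forall fun n => ⟨x n, rfl⟩), fun y => ?_⟩
  -- Monotonicity between `x n` and `y`, divided by `n + 1`; the right side vanishes in the limit.
  have hineq : ∀ n : ℕ, ‖w n‖ ^ 2 - ⟪y - T y, w n⟫ ≤ 1 / ((n : ℝ) + 1) * ⟪y - T y - w n, y⟫ := by
    intro n
    have h := hmono (x n) y
    change 0 ≤ ⟪w n - (y - T y), x n - y⟫ at h
    rw [hxw n] at h
    have hn : (0 : ℝ) < n + 1 := by positivity
    rw [one_div_mul_eq_div, le_div_iff₀ hn]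
    generalize y - T y = c at h ⊢
    simp only [inner_sub_left, inner_sub_right, inner_neg_right, real_inner_smul_right,
      real_inner_self_eq_norm_sq] at h ⊢
    linarith
  have hL : Tendsto (fun n => ‖w n‖ ^ 2 - ⟪y - T y, w n⟫) atTop
      (𝓝 (‖v‖ ^ 2 - ⟪y - T y, v⟫)) :=
    (hv.norm.pow 2).sub (tendsto_const_nhds.inner hv)
  have hR : Tendsto (fun n : ℕ => 1 / ((n : ℝ) + 1) * ⟪y - T y - w n, y⟫) atTop
      (𝓝 (0 * ⟪y - T y - v, y⟫)) :=
    tendsto_one_div_add_atTop_nhds_zero_nat.mul ((hv.const_sub _).inner tendsto_const_nhds)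
  have := le_of_tendsto_of_tendsto' hL hR hineq
  linarith

/-- Displacements along two orbits are asymptotically equal. -/
theorem tendsto_norm_displacement_sub
    (hT : ∀ x y, 3 / 4 * ‖(x - T x) - (y - T y)‖ ^ 2 ≤ ⟪(x - T x) - (y - T y), x - y⟫)
    {x y : ℕ → H} (hx : ∀ n, x (n + 1) = T (x n)) (hy : ∀ n, y (n + 1) = T (y n)) :
    Tendsto (fun n => ‖(x n - T (x n)) - (y n - T (y n))‖) atTop (𝓝 0) := by
  have hstep : ∀ n, 1 / 2 * ‖(x n - T (x n)) - (y n - T (y n))‖ ^ 2 ≤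
      ‖x n - y n‖ ^ 2 - ‖x (n + 1) - y (n + 1)‖ ^ 2 := by
    intro n
    rw [hx, hy]
    linarith [norm_sub_sq_le_of_displacement_cocoercive hT (x n) (y n)]
  -- A nonincreasing sequence bounded below has decrements tending to 0, and these dominate the
  -- displacement gap.
  have hanti : Antitone fun n => ‖x n - y n‖ ^ 2 := antitone_nat_of_succ_le fun n => by
    linarith [hstep n, sq_nonneg ‖(x n - T (x n)) - (y n - T (y n))‖]
  have hlim := tendsto_atTop_ciInf hanti ⟨0, by rintro _ ⟨n, rfl⟩; positivity⟩
  have hdiff := ((hlim.sub (hlim.comp (tendsto_add_atTop_nat 1))).const_mul 2).sqrt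
  rw [sub_self, mul_zero, Real.sqrt_zero] at hdiff
  refine squeeze_zero (fun _ => norm_nonneg _) (fun n => Real.le_sqrt_of_sq_le ?_) hdiff
  have := hstep n
  simp only [Function.comp_apply]
  linarith

/-- The displacements along an orbit converge to the minimal displacement vector. -/
theorem tendsto_displacement
    (hT : ∀ x y, 3 / 4 * ‖(x - T x) - (y - T y)‖ ^ 2 ≤ ⟪(x - T x) - (y - T y), x - y⟫)
    {v : H} (hv : v ∈ closure (range fun z => z - T z)) (hvar : ∀ y, ‖v‖ ^ 2 ≤ ⟪y - T y, v⟫)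
    {x : ℕ → H} (hx : ∀ n, x (n + 1) = T (x n)) :
    Tendsto (fun n => x n - T (x n)) atTop (𝓝 v) := by
  have hlow : ∀ y, ‖v‖ ≤ ‖y - T y‖ := by
    intro y
    have h := (hvar y).trans (real_inner_le_norm _ _)
    nlinarith [norm_nonneg v, norm_nonneg (y - T y)]
  have hnorm : Tendsto (fun n => ‖x n - T (x n)‖) atTop (𝓝 ‖v‖) := by
    rw [Metric.tendsto_atTop]
    intro ε hε
    -- Displacement norms never increase along the orbit of `z`, so they stay within `ε / 2` of
    -- `‖v‖`.
    obtain ⟨_, ⟨z, rfl⟩, hz⟩ := Metric.mem_closure_iff.1 hv (ε / 2) (half_pos hε)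
    let y : ℕ → H := fun n => T^[n] z
    have hy : ∀ n, y (n + 1) = T (y n) := fun n => Function.iterate_succ_apply' T n z
    have hyn : ∀ n, ‖y n - T (y n)‖ ≤ ‖z - T z‖ := by
      intro n
      induction n with
      | zero => exact le_rfl
      | succ n ih =>
        rw [hy n]
        refine (norm_sub_le_of_displacement_cocoercive hT _ _).trans ?_
        exact ih
    obtain ⟨N, hN⟩ := Metric.tendsto_atTop.1 (tendsto_norm_displacement_sub hT hx hy) (ε / 2)
      (half_pos hε)
    refine ⟨N, fun n hn => ?_⟩
    have h1 := hN n hn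
    rw [Real.dist_eq, sub_zero, abs_norm] at h1
    have h2 := norm_le_norm_add_norm_sub' (x n - T (x n)) (y n - T (y n))
    rw [dist_eq_norm, norm_sub_rev] at hz
    rw [Real.dist_eq, abs_of_nonneg (sub_nonneg.2 (hlow _))]
    have h4 := hyn n
    have h5 : ‖z - T z‖ - ‖v‖ ≤ ‖z - T z - v‖ := norm_sub_norm_le _ _
    linarith
  rw [tendsto_iff_norm_sub_tendsto_zero]
  have hs : Tendsto (fun n => √(‖x n - T (x n)‖ ^ 2 - ‖v‖ ^ 2)) atTop (𝓝 0) := by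
    have h := ((hnorm.pow 2).sub_const (‖v‖ ^ 2)).sqrt
    rwa [sub_self (‖v‖ ^ 2), Real.sqrt_zero] at h
  refine squeeze_zero (fun _ => norm_nonneg _) (fun n => Real.le_sqrt_of_sq_le ?_) hs
  -- The variational inequality turns the expansion into `‖w - v‖² ≤ ‖w‖² - ‖v‖²` for a displacement
  -- `w`.
  rw [norm_sub_sq_real]
  linarith [hvar (x n)]

/-- The variational inequality identifies the unique nearest point to `0`. -/
theorem isProjection_closure_displacement_iff {v : H}
    (hv : v ∈ closure (range fun z => z - T z)) (hvar : ∀ y, ‖v‖ ^ 2 ≤ ⟪y - T y, v⟫) (p : H) :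
    IsProjection (closure (range fun z => z - T z)) 0 p ↔ p = v := by
  have hcl : ∀ c ∈ closure (range fun z => z - T z), ‖v‖ ^ 2 ≤ ⟪c, v⟫ := by
    intro c hc
    have hclosed : IsClosed {c : H | ‖v‖ ^ 2 ≤ ⟪c, v⟫} :=
      isClosed_le continuous_const (continuous_id.inner continuous_const)
    exact closure_minimal (by rintro _ ⟨y, rfl⟩; exact hvar y) hclosed hc
  constructor
  · rintro ⟨hp, hmin⟩
    have h1 := hmin v hv
    rw [zero_sub, zero_sub, norm_neg, norm_neg] at h1
    have h2 : ‖p - v‖ ^ 2 ≤ 0 := by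
      rw [norm_sub_sq_real]
      nlinarith [hcl p hp, norm_nonneg p, norm_nonneg v]
    rw [← sub_eq_zero, ← norm_eq_zero]
    exact pow_eq_zero_iff two_ne_zero |>.1 (le_antisymm h2 (sq_nonneg _))
  · rintro rfl
    refine ⟨hv, fun c hc => ?_⟩
    rw [zero_sub, zero_sub, norm_neg, norm_neg]
    have h := (hcl c hc).trans (real_inner_le_norm _ _)
    nlinarith [norm_nonneg p, norm_nonneg c]

theorem IsFISTA.succ_eq {τ : ℕ → ℝ} {x y : ℕ → H} (hx : IsFISTA T τ x y)
    (hτ : ∀ n : ℕ, 1 ≤ n → τ n = 1) (n : ℕ) : x (n + 1) = T (x n) := by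
  rw [hx.x_step (n + 1) (Nat.le_add_left 1 n)]
  rcases n with _ | n
  · rw [hx.init]
  · rw [hx.y_step (n + 1) (Nat.le_add_left 1 n), hτ (n + 1) (Nat.le_add_left 1 n)]
    simp

end Displacement

end ProxGrad

theorem propositionp {H : Type*} [NormedAddCommGroup H] [InnerProductSpace ℝ H] [CompleteSpace H]
    (f : H → ℝ) (g : H → EReal) (β γ : ℝ)
    (hf_convex : ConvexOn ℝ univ f)
    (hf_diff : Differentiable ℝ f)
    (hβ : 0 < β)
    (hf_lip : ∀ a b : H, ‖gradient f a - gradient f b‖ ≤ β * ‖a - b‖)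
    (hg_convex : ProxGrad.ConvexEReal g)
    (hg_lsc : LowerSemicontinuous g)
    (hg_proper : ProxGrad.Proper g)
    (hγ_pos : 0 < γ) (hγ_le : γ ≤ 1 / β)
    (τ : ℕ → ℝ) (x y : ℕ → H)
    (hx : ProxGrad.IsFISTA (ProxGrad.fbOp f g γ) τ x y)
    (hτ : ∀ n : ℕ, 1 ≤ n → τ n = 1) :
    (∃! v : H, ProxGrad.IsProjection
        (closure (range fun z : H => z - ProxGrad.fbOp f g γ z)) 0 v) ∧
      ∀ v : H, ProxGrad.IsProjection
          (closure (range fun z : H => z - ProxGrad.fbOp f g γ z)) 0 v →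
        Tendsto (fun n : ℕ => x (n + 1) - x n) atTop (𝓝 (-v)) := by
  have hT := ProxGrad.fbOp_displacement_cocoercive hf_convex hf_diff hβ hf_lip hg_convex hg_lsc
    hg_proper hγ_pos hγ_le
  obtain ⟨v, hv, hvar⟩ := ProxGrad.exists_minimal_displacement hT
  have hiff := ProxGrad.isProjection_closure_displacement_iff hv hvar
  refine ⟨⟨v, (hiff v).2 rfl, fun p hp => (hiff p).1 hp⟩, fun p hp => ?_⟩
  rw [(hiff p).1 hp]
  have hstep := hx.succ_eq hτ
  refine (ProxGrad.tendsto_displacement hT hv hvar hstep).neg.congr fun n => ?_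
  rw [hstep n, neg_sub]
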